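/- Let $m\ge 1$ and $n=\frac{3^m-1}{2}$. Let $H(n,3)$ be the graph on $\mathbb F_3^n$ in which two words are adjacent if they differ in exactly one position. A $1$-perfect code in $H(n,3)$ is an independent set $C$ of vertices such that every vertex outside $C$ is adjacent to exactly one element of $C$; its rank is the dimension of the affine span of $C$ over $\mathbb F_3$, and it is said to be of rank at most $+1$ if its rank is at most $n-m+1$. An automorphism of $H(n,3)$ of the form $\beta(c_0,\dots,c_{n-1})=\big(\theta_0(c_{\pi^{-1}(0)}),\dots,\theta_{n-1}(c_{\pi^{-1}(n-1)})\big)$, with $\pi$ a permutation of the coordinates and $\theta_0,\dots,\theta_{n-1}$ permutations of $\mathbb F_3$, is said to act only on the coordinates $i$ and $j$ if $\pi(k)=k$ and $\theta_k=\mathrm{id}$ for all $k\notin\{i,j\}$. A $1$-perfect code $C'$ is a two-coordinate switching of a $1$-perfect code $C$ if $C'\subseteq C\cup\beta(C)$ for some automorphism $\beta$ that acts only on some coordinates $i$ and $j$ (for $n=1$, $i=j$ is allowed). Then the set of $1$-perfect codes of rank at most $+1$ in $H(n,3)$ is connected with respect to two-coordinate switching: for any two such codes $C$ and $D$ there is a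 finite sequence $C=C_0,C_1,\dots,C_k=D$ of $1$-perfect codes in $H(n,3)$ of rank at most $+1$ such that $C_{l+1}$ is a two-coordinate switching of $C_l$ for every $0\le l<k$. -/

import Mathlib

/-- Words of length `n` over the ternary alphabet, identified with the field of order `3`. -/
abbrev TernaryWord (n : ℕ) : Type := Fin n → ZMod 3

/-- The Hamming graph `H(n,3)`: two words are adjacent if they differ in exactly one position. -/
def ternaryHammingGraph (n : ℕ) : SimpleGraph (TernaryWord n) where
  Adj x y := hammingDist x y = 1
  symm := ⟨fun x y h => by rw [hammingDist_comm]; exact h⟩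
  loopless := ⟨fun x h => by simp at h⟩

/-- A `1`-perfect code in a graph: an independent set of vertices such that every vertex outside
it is adjacent to exactly one of its elements. -/
def IsOnePerfectCode {V : Type*} (G : SimpleGraph V) (C : Set V) : Prop :=
  G.IsIndepSet C ∧ ∀ v, v ∉ C → ∃! c, c ∈ C ∧ G.Adj v c

/-- The rank of a ternary code: the dimension of its affine span. -/
noncomputable def codeRank {n : ℕ} (C : Set (TernaryWord n)) : ℕ :=
  Module.finrank (ZMod 3) (affineSpan (ZMod 3) C).direction

/-- The automorphism `(π, θ)` of `H(n,3)`: the coordinates are permuted by `π`, and then the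
symbol in each position `k` is changed by the permutation `θ k` of the alphabet. -/
def hammingAut {n : ℕ} (π : Equiv.Perm (Fin n)) (θ : Fin n → Equiv.Perm (ZMod 3))
    (c : TernaryWord n) : TernaryWord n :=
  fun k => θ k (c (π.symm k))

/-- `C'` is a two-coordinate switching of `C`: `C' ⊆ C ∪ β(C)` for some automorphism
`β = (π, θ)` such that `π` fixes every coordinate, and `θ` fixes the values of every coordinate,
except maybe the `i`th and the `j`th one. Admitting `i = j` changes nothing for `n ≥ 2`; it gives
the relation its natural meaning when there is only one coordinate. -/
def IsTwoCoordinateSwitching {n : ℕ} (C C' : Set (TernaryWord n)) : Prop :=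
  ∃ (i j : Fin n) (π : Equiv.Perm (Fin n)) (θ : Fin n → Equiv.Perm (ZMod 3)),
    (∀ k, k ≠ i → k ≠ j → π k = k ∧ θ k = Equiv.refl (ZMod 3)) ∧
    C' ⊆ C ∪ hammingAut π θ '' C

/-- The set of ternary `1`-perfect codes of length `n` and of rank at most `(n - m) + r`
(used for `n = (3 ^ m - 1) / 2`, when `n - m` is the dimension of the Hamming code: these are
the codes of rank at most `+r`). -/
def onePerfectCodesOfRankLE (n m r : ℕ) : Set (Set (TernaryWord n)) :=
  {C | IsOnePerfectCode (ternaryHammingGraph n) C ∧ codeRank C ≤ (n - m) + r}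

/-!
The words of a code of rank at most `+1` satisfy `m - 1` independent affine check equations
`φ x = b`. Counting the words of the space by the balls around the codewords shows that `φ` takes
each value three times on the ball of radius one. After changes of signs, which are products of
switchings, `φ` has one zero column `o` and its other columns come in blocks of three equal
ones, and the code is given by `φ x = b` and `x o = f x`, where `f` does not depend on `x o` and is
a Latin cube on each block.

A Latin cube of order three is affine, and its slopes in the directions `e_j - e_k` within a block
are all equal up to orientation, so that only one sign per block depends on the values of the other
coordinates. Swapping two coordinates of a block at the words where this sign is wrong is a
two-coordinate switching, and it makes the slopes agree with those of a fixed linear Latin function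
`Λ`. Then `f - Λ` is constant along the blocks, and two shifts of the coordinate `o` turn `f` into
`Λ` and the code into an affine Hamming code. All of these are equivalent, and every automorphism
of the Hamming graph is a product of automorphisms each of which acts on at most two coordinates.
-/

open Function Relation
open scoped fwdDiff

section TernaryAlphabet

theorem ternary_eq_neg_of_ne {p q : ZMod 3} (hp : p ≠ 0) (hq : q ≠ 0) (hpq : p ≠ q) :
    p = -q := by
  revert p q
  decide

theorem ternary_eq_add_one_of_ne {s t : ZMod 3} (h : s ≠ t) : s = t + 1 ∨ t = s + 1 := by
  revert s t
  decide

theorem ternary_apply_eq_of_injective {g : ZMod 3 → ZMod 3} (hg : Injective g) (t : ZMod 3) :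
    g t = g 0 + t * (g 1 - g 0) := by
  revert g t
  decide

theorem ternary_units_eq_or_eq_neg (u w : (ZMod 3)ˣ) : u = w ∨ u = -w := by
  revert u w
  decide

end TernaryAlphabet

section PerfectCodes

variable {V V' : Type*} {G : SimpleGraph V} {G' : SimpleGraph V'} {C : Set V}

theorem isOnePerfectCode_iff_existsUnique :
    IsOnePerfectCode G C ↔ ∀ v, ∃! c, c ∈ C ∧ (v = c ∨ G.Adj v c) := by
  constructor
  · rintro ⟨hind, hcov⟩ v
    by_cases hv : v ∈ C
    · exact ⟨v, ⟨hv, .inl rfl⟩, fun c ⟨hc, h⟩ =>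
        h.elim Eq.symm fun hvc => absurd hvc (hind hv hc hvc.ne)⟩
    · obtain ⟨c, ⟨hc, hvc⟩, huniq⟩ := hcov v hv
      exact ⟨c, ⟨hc, .inr hvc⟩, fun c' ⟨hc', h⟩ =>
        huniq c' ⟨hc', h.resolve_left fun hvc' => hv (hvc' ▸ hc')⟩⟩
  · refine fun h => ⟨fun x hx y hy hxy hadj => hxy ?_, fun v hv => ?_⟩
    · exact (h x).unique ⟨hx, .inl rfl⟩ ⟨hy, .inr hadj⟩
    · obtain ⟨c, ⟨hc, hvc⟩, huniq⟩ := h v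
      exact ⟨c, ⟨hc, hvc.resolve_left fun hvc' => hv (hvc' ▸ hc)⟩,
        fun c' ⟨hc', hvc'⟩ => huniq c' ⟨hc', .inr hvc'⟩⟩

theorem IsOnePerfectCode.image_iso (hC : IsOnePerfectCode G C) (e : G ≃g G') :
    IsOnePerfectCode G' (e '' C) := by
  rw [isOnePerfectCode_iff_existsUnique] at hC ⊢
  intro v
  obtain ⟨w, rfl⟩ := e.surjective v
  obtain ⟨c, ⟨hc, hwc⟩, huniq⟩ := hC w
  refine ⟨e c, ⟨⟨c, hc, rfl⟩, hwc.imp (congrArg e) e.map_adj_iff.2⟩, ?_⟩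
  rintro _ ⟨⟨c', hc', rfl⟩, hwc'⟩
  exact congrArg e (huniq c' ⟨hc', hwc'.imp (e.injective ·) e.map_adj_iff.1⟩)

end PerfectCodes

section Automorphisms

variable {n m r : ℕ} {C : Set (TernaryWord n)}

/-- The automorphism `hammingAut π θ` as a permutation of the set of words. -/
def hammingAutEquiv (π : Equiv.Perm (Fin n)) (θ : Fin n → Equiv.Perm (ZMod 3)) :
    Equiv.Perm (TernaryWord n) :=
  (π.arrowCongr (Equiv.refl _)).trans (Equiv.piCongrRight θ)

theorem coe_hammingAutEquiv_symm (π : Equiv.Perm (Fin n)) (θ : Fin n → Equiv.Perm (ZMod 3)) :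
    ⇑(hammingAutEquiv π θ).symm = hammingAut π⁻¹ fun k => (θ (π k))⁻¹ :=
  rfl

theorem hammingDist_hammingAut (π : Equiv.Perm (Fin n)) (θ : Fin n → Equiv.Perm (ZMod 3))
    (x y : TernaryWord n) :
    hammingDist (hammingAut π θ x) (hammingAut π θ y) = hammingDist x y := by
  simp only [hammingDist, hammingAut, ne_eq, (θ _).injective.eq_iff]
  exact Finset.card_equiv π.symm (by simp)

/-- The automorphism `hammingAut π θ` as an automorphism of the Hamming graph. -/
def hammingIso (π : Equiv.Perm (Fin n)) (θ : Fin n → Equiv.Perm (ZMod 3)) :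
    ternaryHammingGraph n ≃g ternaryHammingGraph n where
  toEquiv := hammingAutEquiv π θ
  map_rel_iff' {x y} := by
    change hammingDist (hammingAut π θ x) (hammingAut π θ y) = 1 ↔ hammingDist x y = 1
    rw [hammingDist_hammingAut]

theorem codeRank_image_hammingAut_le (C : Set (TernaryWord n)) (π : Equiv.Perm (Fin n))
    (θ : Fin n → Equiv.Perm (ZMod 3)) : codeRank (hammingAut π θ '' C) ≤ codeRank C := by
  -- Every permutation of the field of order three is affine, hence so is the automorphism.
  let A : TernaryWord n →ᵃ[ZMod 3] TernaryWord n :=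
    { toFun := hammingAut π θ
      linear := LinearMap.pi fun k => (θ k 1 - θ k 0) • LinearMap.proj (π.symm k)
      map_vadd' := fun p v => by
        funext k
        simp only [hammingAut, vadd_eq_add, Pi.add_apply, LinearMap.pi_apply,
          LinearMap.smul_apply, LinearMap.proj_apply, smul_eq_mul,
          ternary_apply_eq_of_injective (θ k).injective (v _ + p _),
          ternary_apply_eq_of_injective (θ k).injective (p _)]
        ring }
  change codeRank (A '' C) ≤ _
  rw [codeRank, codeRank, direction_affineSpan, direction_affineSpan, ← AffineMap.map_vectorSpan]
  exact Submodule.finrank_map_le _ _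

theorem image_hammingAut_mem (hC : C ∈ onePerfectCodesOfRankLE n m r) (π : Equiv.Perm (Fin n))
    (θ : Fin n → Equiv.Perm (ZMod 3)) : hammingAut π θ '' C ∈ onePerfectCodesOfRankLE n m r :=
  ⟨hC.1.image_iso (hammingIso π θ), (codeRank_image_hammingAut_le C π θ).trans hC.2⟩

end Automorphisms

section Switching

variable {n m r : ℕ} {C D : Set (TernaryWord n)} {i j : Fin n} {π : Equiv.Perm (Fin n)}
  {θ : Fin n → Equiv.Perm (ZMod 3)}

/-- The automorphism `(π, θ)` acts only on the coordinates `i` and `j`. -/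
def ActsOnlyOn (i j : Fin n) (π : Equiv.Perm (Fin n)) (θ : Fin n → Equiv.Perm (ZMod 3)) : Prop :=
  ∀ k, k ≠ i → k ≠ j → π k = k ∧ θ k = Equiv.refl (ZMod 3)

theorem ActsOnlyOn.inv (h : ActsOnlyOn i j π θ) :
    ActsOnlyOn i j π⁻¹ fun k => (θ (π k))⁻¹ := by
  intro k hi hj
  obtain ⟨hπ, hθ⟩ := h k hi hj
  refine ⟨Equiv.Perm.inv_eq_iff_eq.2 hπ.symm, ?_⟩
  simp only [hπ, hθ]
  rfl

theorem actsOnlyOn_swap (i j : Fin n) : ActsOnlyOn i j (Equiv.swap i j) 1 :=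
  fun _ hi hj => ⟨Equiv.swap_apply_of_ne_of_ne hi hj, rfl⟩

theorem actsOnlyOn_mulSingle (i : Fin n) (σ : Equiv.Perm (ZMod 3)) :
    ActsOnlyOn i i 1 (Pi.mulSingle i σ) :=
  fun _ hi _ => ⟨rfl, Pi.mulSingle_eq_of_ne hi _⟩

/-- Both codes are `1`-perfect of rank at most `+r`, and each of them is a two-coordinate switching
of the other. Unlike `IsTwoCoordinateSwitching`, this relation is symmetric by construction. -/
def MutualSwitching (m r : ℕ) (C D : Set (TernaryWord n)) : Prop :=
  C ∈ onePerfectCodesOfRankLE n m r ∧ D ∈ onePerfectCodesOfRankLE n m r ∧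
    IsTwoCoordinateSwitching C D ∧ IsTwoCoordinateSwitching D C

/-- Connectedness of codes by chains of mutual two-coordinate switchings through `1`-perfect codes
of rank at most `+r`. -/
def SwitchConnected (m r : ℕ) : Set (TernaryWord n) → Set (TernaryWord n) → Prop :=
  ReflTransGen (MutualSwitching m r)

theorem SwitchConnected.symm (h : SwitchConnected m r C D) : SwitchConnected m r D C := by
  have : Std.Symm (MutualSwitching (n := n) m r) :=
    ⟨fun _ _ ⟨hC, hD, hCD, hDC⟩ => ⟨hD, hC, hDC, hCD⟩⟩
  exact symm_of (ReflTransGen (MutualSwitching m r)) h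

theorem SwitchConnected.mem (h : SwitchConnected m r C D)
    (hC : C ∈ onePerfectCodesOfRankLE n m r) : D ∈ onePerfectCodesOfRankLE n m r := by
  induction h with
  | refl => exact hC
  | tail _ hs _ => exact hs.2.1

theorem SwitchConnected.reflTransGen (h : SwitchConnected m r C D)
    (hC : C ∈ onePerfectCodesOfRankLE n m r) (hD : D ∈ onePerfectCodesOfRankLE n m r) :
    ReflTransGen
      (fun A B : onePerfectCodesOfRankLE n m r =>
        IsTwoCoordinateSwitching (A : Set (TernaryWord n)) (B : Set (TernaryWord n)))
      ⟨C, hC⟩ ⟨D, hD⟩ := by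
  induction h with
  | refl => exact .refl
  | tail _ hs ih => exact (ih hs.1).tail hs.2.2.1

theorem switchConnected_of_subset_union (hC : C ∈ onePerfectCodesOfRankLE n m r)
    (hD : D ∈ onePerfectCodesOfRankLE n m r) (h : ActsOnlyOn i j π θ)
    (hDC : D ⊆ C ∪ hammingAut π θ '' C) (hCD : C ⊆ D ∪ hammingAut π θ ⁻¹' D) :
    SwitchConnected m r C D := by
  refine .single ⟨hC, hD, ⟨i, j, π, θ, h, hDC⟩, i, j, π⁻¹, _, h.inv, ?_⟩
  rwa [← coe_hammingAutEquiv_symm, Equiv.image_symm_eq_preimage]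

theorem switchConnected_image_of_actsOnlyOn (hC : C ∈ onePerfectCodesOfRankLE n m r)
    (h : ActsOnlyOn i j π θ) : SwitchConnected m r C (hammingAut π θ '' C) :=
  switchConnected_of_subset_union hC (image_hammingAut_mem hC π θ) h Set.subset_union_right
    ((Set.subset_preimage_image _ C).trans Set.subset_union_right)

/-- The permutations of the set of words that map each `1`-perfect code of rank at most `+r` to a
code connected to it. -/
def switchConnectingSubmonoid (n m r : ℕ) : Submonoid (Equiv.Perm (TernaryWord n)) where
  carrier := {g | ∀ C ∈ onePerfectCodesOfRankLE n m r, SwitchConnected m r C (g '' C)}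
  one_mem' C _ := by
    rw [Equiv.Perm.coe_one, Set.image_id]
    exact .refl
  mul_mem' {g h} hg hh C hC := by
    rw [Equiv.Perm.coe_mul, Set.image_comp]
    exact (hh C hC).trans (hg _ ((hh C hC).mem hC))

theorem hammingAutEquiv_perm_mem (π : Equiv.Perm (Fin n)) :
    hammingAutEquiv π 1 ∈ switchConnectingSubmonoid n m r := by
  induction π using Equiv.Perm.swap_induction_on with
  | one => exact one_mem _
  | swap_mul σ i j _ ih =>
    have hswap : hammingAutEquiv (Equiv.swap i j) 1 ∈ switchConnectingSubmonoid n m r :=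
      fun _ hC => switchConnected_image_of_actsOnlyOn hC (actsOnlyOn_swap i j)
    have hmul : hammingAutEquiv (Equiv.swap i j * σ) 1 =
        hammingAutEquiv (Equiv.swap i j) 1 * hammingAutEquiv σ 1 := rfl
    exact hmul ▸ mul_mem hswap ih

theorem hammingAutEquiv_symbols_mem (θ : Fin n → Equiv.Perm (ZMod 3)) :
    hammingAutEquiv 1 θ ∈ switchConnectingSubmonoid n m r := by
  let H : Submonoid (Fin n → Equiv.Perm (ZMod 3)) :=
    { carrier := {θ | hammingAutEquiv 1 θ ∈ switchConnectingSubmonoid n m r}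
      one_mem' := (switchConnectingSubmonoid n m r).one_mem
      mul_mem' := fun {θ θ'} hθ hθ' => by
        have hmul : hammingAutEquiv 1 (θ * θ') =
            hammingAutEquiv 1 θ * hammingAutEquiv 1 θ' := rfl
        change _ ∈ switchConnectingSubmonoid n m r
        exact hmul ▸ mul_mem hθ hθ' }
  change θ ∈ H
  exact Submonoid.pi_mem_of_mulSingle_mem θ fun i _ hC =>
    switchConnected_image_of_actsOnlyOn hC (actsOnlyOn_mulSingle i (θ i))

theorem switchConnected_image_hammingAut (hC : C ∈ onePerfectCodesOfRankLE n m r)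
    (π : Equiv.Perm (Fin n)) (θ : Fin n → Equiv.Perm (ZMod 3)) :
    SwitchConnected m r C (hammingAut π θ '' C) := by
  have hmul : hammingAutEquiv π θ = hammingAutEquiv 1 θ * hammingAutEquiv π 1 := rfl
  have hmem : hammingAutEquiv π θ ∈ switchConnectingSubmonoid n m r :=
    hmul ▸ mul_mem (hammingAutEquiv_symbols_mem θ) (hammingAutEquiv_perm_mem π)
  exact hmem C hC

end Switching

section Ball

variable {n : ℕ} {C : Set (TernaryWord n)}

/-- An enumeration of the words of Hamming weight at most one, i.e. of the ball of radius one
around the zero word. -/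
def ballVec : Option (Fin n × (ZMod 3)ˣ) → TernaryWord n
  | none => 0
  | some (j, u) => Pi.single j (u : ZMod 3)

theorem ballVec_injective : Injective (ballVec (n := n)) := by
  rintro (_ | ⟨j, u⟩) (_ | ⟨k, w⟩) h
  · rfl
  · exact absurd h.symm (Pi.single_ne_zero_iff.2 w.ne_zero)
  · exact absurd h (Pi.single_ne_zero_iff.2 u.ne_zero)
  · have hjk : j = k := by
      by_contra hjk
      have hj : (u : ZMod 3) = 0 := by simpa [ballVec, hjk] using congrFun h j
      exact u.ne_zero hj
    subst hjk
    rw [Units.ext (Pi.single_injective j h)]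

theorem hammingNorm_eq_one_iff {x : TernaryWord n} :
    hammingNorm x = 1 ↔ ∃ (j : Fin n) (u : (ZMod 3)ˣ), x = Pi.single j (u : ZMod 3) := by
  constructor
  · intro hx
    obtain ⟨j, hj⟩ := Finset.card_eq_one.1 hx
    have hsupp : ∀ k, x k ≠ 0 ↔ k = j := fun k => by simpa using Finset.ext_iff.1 hj k
    refine ⟨j, Units.mk0 _ ((hsupp j).2 rfl), funext fun k => ?_⟩
    rcases eq_or_ne k j with rfl | hk
    · simp
    · simpa [hk] using mt (hsupp k).1 hk
  · rintro ⟨j, u, rfl⟩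
    refine Finset.card_eq_one.2 ⟨j, Finset.ext fun k => ?_⟩
    rcases eq_or_ne k j with rfl | hk <;> simp [*]

theorem eq_or_adj_iff_exists_add_ballVec {v c : TernaryWord n} :
    v = c ∨ (ternaryHammingGraph n).Adj v c ↔ ∃ e, v + ballVec e = c := by
  change v = c ∨ hammingDist v c = 1 ↔ _
  rw [hammingDist_eq_hammingNorm, hammingNorm_eq_one_iff, Option.exists]
  simp only [ballVec, add_zero, Prod.exists, neg_add_eq_iff_eq_add, eq_comm (a := c)]

theorem isOnePerfectCode_iff_ballVec :
    IsOnePerfectCode (ternaryHammingGraph n) C ↔ ∀ v, ∃! e, v + ballVec e ∈ C := by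
  rw [isOnePerfectCode_iff_existsUnique]
  simp only [eq_or_adj_iff_exists_add_ballVec]
  refine forall_congr' fun v => ⟨?_, ?_⟩
  · rintro ⟨_, ⟨hc, e, rfl⟩, huniq⟩
    exact ⟨e, hc, fun e' he' => ballVec_injective (add_left_cancel (huniq _ ⟨he', e', rfl⟩))⟩
  · rintro ⟨e, he, huniq⟩
    refine ⟨_, ⟨he, e, rfl⟩, ?_⟩
    rintro _ ⟨hc, e', rfl⟩
    rw [huniq e' hc]

theorem IsOnePerfectCode.bijective_sub_ballVec (hC : IsOnePerfectCode (ternaryHammingGraph n) C) :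
    Bijective fun p : Option (Fin n × (ZMod 3)ˣ) × C => (p.2 : TernaryWord n) - ballVec p.1 := by
  rw [isOnePerfectCode_iff_ballVec] at hC
  constructor
  · rintro ⟨e, x, hx⟩ ⟨e', y, hy⟩ (h : x - ballVec e = y - ballVec e')
    obtain rfl : e = e' := (hC (x - ballVec e)).unique (by simpa using hx) (by simpa [h] using hy)
    obtain rfl : x = y := sub_left_injective h
    rfl
  · intro v
    obtain ⟨_, he, -⟩ := hC v
    exact ⟨⟨_, ⟨_, he⟩⟩, add_sub_cancel_right _ _⟩

theorem IsOnePerfectCode.nonempty (hC : IsOnePerfectCode (ternaryHammingGraph n) C) :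
    C.Nonempty :=
  let ⟨_, he, _⟩ := isOnePerfectCode_iff_ballVec.1 hC 0
  ⟨_, he⟩

end Ball

section LatinFunctions

variable {ι κ : Type*} [DecidableEq ι]

/-- The difference of the unit vectors at `j` and `k`. -/
def unitDiff (j k : ι) : ι → ZMod 3 := Pi.single j 1 - Pi.single k 1

theorem unitDiff_self (j : ι) : unitDiff j j = 0 := sub_self _

theorem unitDiff_swap (j k : ι) : unitDiff k j = -unitDiff j k := (neg_sub _ _).symm

theorem unitDiff_add_unitDiff (j k l : ι) : unitDiff j k + unitDiff k l = unitDiff j l :=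
  sub_add_sub_cancel _ _ _

/-- The functions `f` whose graph codes `{x | φ x = b ∧ x o = f x}` are `1`-perfect, when `col`
assigns to each coordinate its column in the matrix of `φ`: `f` does not depend on the coordinate
`o`, and passing from `x + Pi.single k 1` to `x + Pi.single j 1` changes its value whenever `j` and
`k` have the same column. On each block of coordinates with the same column, `f` is thus a Latin
hypercube. -/
structure IsLatin (col : ι → κ) (o : ι) (f : (ι → ZMod 3) → ZMod 3) : Prop where
  add_single : ∀ x t, f (x + Pi.single o t) = f x
  fwdDiff_ne_zero : ∀ x {j k}, j ≠ k → col j = col k → Δ_[unitDiff j k] f x ≠ 0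

namespace IsLatin

variable {col : ι → κ} {o : ι} {f g : (ι → ZMod 3) → ZMod 3} {i j k l : ι}

theorem injective_add_smul (hf : IsLatin col o f) (x : ι → ZMod 3) (hjk : j ≠ k)
    (h : col j = col k) : Injective fun t : ZMod 3 => f (x + t • unitDiff j k) := by
  have hstep : ∀ t : ZMod 3, f (x + (t + 1) • unitDiff j k) ≠ f (x + t • unitDiff j k) := by
    intro t
    rw [add_smul, one_smul, ← add_assoc]
    exact sub_ne_zero.1 (hf.fwdDiff_ne_zero _ hjk h)
  intro s t hst
  by_contra hne
  obtain rfl | rfl := ternary_eq_add_one_of_ne hne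
  exacts [hstep _ hst, hstep _ hst.symm]

theorem eq_of_apply_add_single_eq (hf : IsLatin col o f) {x : ι → ZMod 3} {t : ZMod 3}
    (ht : t ≠ 0) (h : col j = col k) (hx : f (x + Pi.single j t) = f (x + Pi.single k t)) :
    j = k := by
  by_contra hjk
  have hline : x + Pi.single j t = x + Pi.single k t + t • unitDiff j k := by
    simp only [unitDiff, smul_sub, ← Pi.single_smul, smul_eq_mul, mul_one]
    abel
  rw [hline] at hx
  exact ht (hf.injective_add_smul (x + Pi.single k t) hjk h (by simpa using hx))

theorem apply_add_smul (hf : IsLatin col o f) (x : ι → ZMod 3) (h : col j = col k)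
    (t : ZMod 3) : f (x + t • unitDiff j k) = f x + t * Δ_[unitDiff j k] f x := by
  rcases eq_or_ne j k with rfl | hjk
  · simp [unitDiff_self, fwdDiff]
  · simpa [fwdDiff] using ternary_apply_eq_of_injective (hf.injective_add_smul x hjk h) t

theorem fwdDiff_swap (hf : IsLatin col o f) (x : ι → ZMod 3) (h : col j = col k) :
    Δ_[unitDiff k j] f x = -Δ_[unitDiff j k] f x := by
  rw [unitDiff_swap, fwdDiff, ← neg_one_smul (ZMod 3), hf.apply_add_smul x h]
  ring

/-- The restrictions of `f` to two distinct parallel lines in the direction `unitDiff j k` differ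
everywhere, hence they have equal slopes. -/
theorem fwdDiff_add_smul (hf : IsLatin col o f) (x : ι → ZMod 3) (h : col j = col k)
    (h' : col i = col l) (t : ZMod 3) :
    Δ_[unitDiff j k] f (x + t • unitDiff i l) = Δ_[unitDiff j k] f x := by
  rcases eq_or_ne i l with rfl | hil
  · simp [unitDiff_self]
  rcases eq_or_ne t 0 with rfl | ht
  · simp
  have hdiff : ∀ s, f (x + t • unitDiff i l) + s * Δ_[unitDiff j k] f (x + t • unitDiff i l) ≠
      f x + s * Δ_[unitDiff j k] f x := by
    intro s hs
    rw [← hf.apply_add_smul _ h, ← hf.apply_add_smul _ h, add_right_comm] at hs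
    exact ht (hf.injective_add_smul (x + s • unitDiff j k) hil h' (by simpa using hs))
  by_contra hne
  refine hdiff ((f x - f (x + t • unitDiff i l)) /
    (Δ_[unitDiff j k] f (x + t • unitDiff i l) - Δ_[unitDiff j k] f x)) ?_
  field_simp [sub_ne_zero.2 hne]
  ring

theorem fwdDiff_add_fwdDiff (hf : IsLatin col o f) (x : ι → ZMod 3) (hjk : col j = col k)
    (hkl : col k = col l) :
    Δ_[unitDiff j k] f x + Δ_[unitDiff k l] f x = Δ_[unitDiff j l] f x := by
  have h := hf.fwdDiff_add_smul x hkl hjk 1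
  rw [one_smul] at h
  rw [← h, ← unitDiff_add_unitDiff j k l]
  simp only [fwdDiff, add_assoc]
  ring

theorem fwdDiff_eq_of_ne (hf : IsLatin col o f) (x : ι → ZMod 3) (hjk : j ≠ k) (hkl : k ≠ l)
    (hjl : j ≠ l) (h : col j = col k) (h' : col k = col l) :
    Δ_[unitDiff k l] f x = Δ_[unitDiff j k] f x := by
  have hsum := hf.fwdDiff_add_fwdDiff x h h'
  have hne := hf.fwdDiff_ne_zero x hjl (h.trans h')
  rw [← hsum] at hne
  by_contra hdiff
  exact hne (by rw [ternary_eq_neg_of_ne (hf.fwdDiff_ne_zero x hkl h')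
    (hf.fwdDiff_ne_zero x hjk h) hdiff, add_neg_cancel])

theorem add_blockConstant (hf : IsLatin col o f) {d : (ι → ZMod 3) → ZMod 3}
    (hdo : ∀ x t, d (x + Pi.single o t) = d x)
    (hd : ∀ x {j k}, col j = col k → d (x + unitDiff j k) = d x) :
    IsLatin col o fun x => f x + d x where
  add_single x t := by rw [hf.add_single, hdo]
  fwdDiff_ne_zero x j k hjk h := by
    rw [fwdDiff, hd x h, add_sub_add_right_eq_sub]
    exact hf.fwdDiff_ne_zero x hjk h

theorem fwdDiff_congr (hf : IsLatin col o f) (hg : IsLatin col o g) (x : ι → ZMod 3)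
    (hjk : j ≠ k) (h : col j = col k) (hfg : Δ_[unitDiff j k] f x = Δ_[unitDiff j k] g x)
    (hi : col i = col j) (hl : col l = col j) :
    Δ_[unitDiff i l] f x = Δ_[unitDiff i l] g x := by
  have hj : ∀ p, col p = col j → Δ_[unitDiff j p] f x = Δ_[unitDiff j p] g x := by
    intro p hp
    rcases eq_or_ne j p with rfl | hjp
    · simp [unitDiff_self, fwdDiff]
    rcases eq_or_ne k p with rfl | hkp
    · exact hfg
    have hp' : col k = col p := h.symm.trans hp.symm
    rw [← hf.fwdDiff_add_fwdDiff x h hp', ← hg.fwdDiff_add_fwdDiff x h hp',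
      hf.fwdDiff_eq_of_ne x hjk hkp hjp h hp', hg.fwdDiff_eq_of_ne x hjk hkp hjp h hp', hfg]
  have hil := hi.trans hl.symm
  linear_combination hj l hl - hj i hi + hf.fwdDiff_add_fwdDiff x hi.symm hil -
    hg.fwdDiff_add_fwdDiff x hi.symm hil

end IsLatin

/-- The function `f` with the coordinates `j` and `k` of the argument swapped wherever the
increment of `f` along `unitDiff j k` is not equal to `s`. If `f` is Latin and `j` and `k` are in
the same block, then all increments along `unitDiff j k` become equal to `s`. -/
def straighten (j k : ι) (s : ZMod 3) (f : (ι → ZMod 3) → ZMod 3) (x : ι → ZMod 3) : ZMod 3 :=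
  if Δ_[unitDiff j k] f x = s then f x else f (x ∘ Equiv.swap j k)

section Straighten

variable {col : ι → κ} {o : ι} {f : (ι → ZMod 3) → ZMod 3} {i j k l : ι} {s : ZMod 3}
  {x : ι → ZMod 3}

theorem comp_swap_eq_add_smul (x : ι → ZMod 3) (j k : ι) :
    x ∘ Equiv.swap j k = x + (x k - x j) • unitDiff j k := by
  funext p
  rcases eq_or_ne p j with rfl | hj
  · rcases eq_or_ne p k with rfl | hk <;> simp [unitDiff, *]
  rcases eq_or_ne p k with rfl | hk
  · simp [unitDiff, hj]
  · simp [unitDiff, hj, hk, Equiv.swap_apply_of_ne_of_ne hj hk]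

theorem apply_swap_eq (h : col j = col k) (i : ι) : col (Equiv.swap j k i) = col i := by
  rw [Equiv.swap_apply_def]
  split_ifs with hj hk
  exacts [hj ▸ h.symm, hk ▸ h, rfl]

theorem straighten_of_eq (h : Δ_[unitDiff j k] f x = s) : straighten j k s f x = f x :=
  if_pos h

theorem straighten_of_ne (h : Δ_[unitDiff j k] f x ≠ s) :
    straighten j k s f x = f (x ∘ Equiv.swap j k) :=
  if_neg h

theorem IsLatin.fwdDiff_straighten_of_eq (hf : IsLatin col o f) (h : col j = col k)
    (h' : col i = col l) (hx : Δ_[unitDiff j k] f x = s) :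
    Δ_[unitDiff i l] (straighten j k s f) x = Δ_[unitDiff i l] f x := by
  have hinv := hf.fwdDiff_add_smul x h h' 1
  rw [one_smul] at hinv
  rw [fwdDiff, straighten_of_eq hx, straighten_of_eq (hinv.trans hx), fwdDiff]

theorem IsLatin.fwdDiff_straighten_of_ne (hf : IsLatin col o f) (h : col j = col k)
    (h' : col i = col l) (hx : Δ_[unitDiff j k] f x ≠ s) :
    Δ_[unitDiff i l] (straighten j k s f) x =
      Δ_[unitDiff (Equiv.swap j k i) (Equiv.swap j k l)] f x := by
  have hinv := hf.fwdDiff_add_smul x h h' 1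
  have hcomp : (x + unitDiff i l) ∘ Equiv.swap j k =
      x ∘ Equiv.swap j k + unitDiff (Equiv.swap j k i) (Equiv.swap j k l) := by
    funext p
    simp [unitDiff, Pi.single_apply, Equiv.swap_apply_eq_iff]
  rw [one_smul] at hinv
  rw [fwdDiff, straighten_of_ne hx, straighten_of_ne (hinv.trans_ne hx), hcomp,
    comp_swap_eq_add_smul x]
  exact hf.fwdDiff_add_smul x (by rw [apply_swap_eq h, apply_swap_eq h, h']) h _

theorem IsLatin.fwdDiff_straighten_self (hf : IsLatin col o f) (hjk : j ≠ k) (h : col j = col k)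
    (hs : s ≠ 0) (x : ι → ZMod 3) : Δ_[unitDiff j k] (straighten j k s f) x = s := by
  by_cases hx : Δ_[unitDiff j k] f x = s
  · rw [hf.fwdDiff_straighten_of_eq h h hx, hx]
  · rw [hf.fwdDiff_straighten_of_ne h h hx, Equiv.swap_apply_left, Equiv.swap_apply_right,
      hf.fwdDiff_swap x h, ternary_eq_neg_of_ne (hf.fwdDiff_ne_zero x hjk h) hs hx, neg_neg]

theorem IsLatin.isLatin_straighten (hf : IsLatin col o f) (hoj : o ≠ j) (hok : o ≠ k)
    (h : col j = col k) (s : ZMod 3) : IsLatin col o (straighten j k s f) where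
  add_single x t := by
    have hcomp : (x + Pi.single o t) ∘ Equiv.swap j k = x ∘ Equiv.swap j k + Pi.single o t := by
      funext p
      simp [Pi.single_apply, Equiv.swap_apply_eq_iff, Equiv.swap_apply_of_ne_of_ne hoj hok]
    have hinv : Δ_[unitDiff j k] f (x + Pi.single o t) = Δ_[unitDiff j k] f x := by
      simp only [fwdDiff, add_right_comm x, hf.add_single]
    rw [straighten, straighten, hinv, hcomp, hf.add_single, hf.add_single]
  fwdDiff_ne_zero x i l hil h' := by
    by_cases hx : Δ_[unitDiff j k] f x = s
    · rw [hf.fwdDiff_straighten_of_eq h h' hx]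
      exact hf.fwdDiff_ne_zero x hil h'
    · rw [hf.fwdDiff_straighten_of_ne h h' hx]
      exact hf.fwdDiff_ne_zero x ((Equiv.swap j k).injective.ne hil)
        (by rw [apply_swap_eq h, apply_swap_eq h, h'])

theorem IsLatin.fwdDiff_straighten_of_fwdDiff_eq {Λ : (ι → ZMod 3) →ₗ[ZMod 3] ZMod 3}
    (hΛ : IsLatin col o Λ) (hf : IsLatin col o f) (h : col j = col k) (h' : col i = col l)
    (hil : Δ_[unitDiff i l] f x = Λ (unitDiff i l)) :
    Δ_[unitDiff i l] (straighten j k (Λ (unitDiff j k)) f) x = Λ (unitDiff i l) := by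
  have hinc : ∀ p q, Δ_[unitDiff p q] Λ x = Λ (unitDiff p q) := fun p q => by
    rw [fwdDiff, map_add, add_sub_cancel_left]
  by_cases hx : Δ_[unitDiff j k] f x = Λ (unitDiff j k)
  · rw [hf.fwdDiff_straighten_of_eq h h' hx, hil]
  rcases eq_or_ne i l with rfl | hne
  · simp [unitDiff_self, fwdDiff]
  have hij : col i ≠ col j := fun hij => hx <| by
    rw [← hinc] at hil ⊢
    exact hf.fwdDiff_congr hΛ x hne h' hil hij.symm (h.symm.trans hij.symm)
  have hfix : ∀ p, col p = col i → Equiv.swap j k p = p := fun p hp =>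
    Equiv.swap_apply_of_ne_of_ne (fun hpj => hij (by rw [← hp, hpj]))
      (fun hpk => hij (by rw [← hp, hpk, h]))
  rw [hf.fwdDiff_straighten_of_ne h h' hx, hfix i rfl, hfix l h'.symm, hil]

end Straighten

end LatinFunctions

section LinearChecks

variable {n m : ℕ} {K : Type*} [AddCommGroup K] [Module (ZMod 3) K]

/-- The `j`th column of the matrix of a linear map on words. -/
def checkColumn (φ : TernaryWord n →ₗ[ZMod 3] K) (j : Fin n) : K := φ (Pi.single j 1)

variable {φ : TernaryWord n →ₗ[ZMod 3] K} {o j k : Fin n} {b : K}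
  {f g : TernaryWord n → ZMod 3} {C : Set (TernaryWord n)}

theorem map_single_eq_smul_checkColumn (φ : TernaryWord n →ₗ[ZMod 3] K) (j : Fin n) (t : ZMod 3) :
    φ (Pi.single j t) = t • checkColumn φ j := by
  rw [checkColumn, ← map_smul, ← Pi.single_smul, smul_eq_mul, mul_one]

theorem map_unitDiff (h : checkColumn φ j = checkColumn φ k) : φ (unitDiff j k) = 0 := by
  rw [unitDiff, map_sub, sub_eq_zero]
  exact h

theorem map_ballVec_some (φ : TernaryWord n →ₗ[ZMod 3] K) (j : Fin n) (u : (ZMod 3)ˣ) :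
    φ (ballVec (some (j, u))) = u • checkColumn φ j :=
  map_single_eq_smul_checkColumn φ j u

/-- The linear map `φ` takes each value three times on the ball of radius one, its only zero column
is the `o`th one, and its other columns are normalized so that no two of them are opposite. These
are, after a change of signs, the linear maps that are constant on a `1`-perfect code of rank at
most `+1`. -/
structure IsTripleCheck (φ : TernaryWord n →ₗ[ZMod 3] K) (o : Fin n) : Prop where
  card_fiber : ∀ r, Nat.card {e // φ (ballVec e) = r} = 3
  checkColumn_eq_zero_iff : ∀ {j}, checkColumn φ j = 0 ↔ j = o
  normalized : ∀ {j k}, checkColumn φ j = -checkColumn φ k → checkColumn φ j = 0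

/-- The code `{(x', f x') | φ x' = b}`, where `f` does not depend on the coordinate `o`, in which
its value is written. -/
def graphCode (φ : TernaryWord n →ₗ[ZMod 3] K) (b : K) (o : Fin n)
    (f : TernaryWord n → ZMod 3) : Set (TernaryWord n) :=
  {x | φ x = b ∧ x o = f x}

namespace IsTripleCheck

theorem map_single (hφ : IsTripleCheck φ o) (t : ZMod 3) : φ (Pi.single o t) = 0 := by
  rw [map_single_eq_smul_checkColumn, hφ.checkColumn_eq_zero_iff.2 rfl, smul_zero]

theorem map_add_single (hφ : IsTripleCheck φ o) (x : TernaryWord n) (t : ZMod 3) :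
    φ (x + Pi.single o t) = φ x := by
  rw [map_add, hφ.map_single, add_zero]

theorem ne_of_checkColumn_eq (hφ : IsTripleCheck φ o) (hjk : j ≠ k)
    (h : checkColumn φ j = checkColumn φ k) : o ≠ j := by
  rintro rfl
  rw [hφ.checkColumn_eq_zero_iff.2 rfl, eq_comm, hφ.checkColumn_eq_zero_iff] at h
  exact hjk h.symm

theorem exists_ballVec_eq_single (hφ : IsTripleCheck φ o) {e : Option (Fin n × (ZMod 3)ˣ)}
    (he : φ (ballVec e) = 0) : ∃ s, ballVec e = Pi.single o s := by
  rcases e with _ | ⟨j, u⟩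
  · exact ⟨0, (Pi.single_zero o).symm⟩
  · rw [map_ballVec_some, smul_eq_zero_iff_eq, hφ.checkColumn_eq_zero_iff] at he
    exact ⟨u, he ▸ rfl⟩

theorem eq_of_smul_checkColumn_eq (hφ : IsTripleCheck φ o) {u w : (ZMod 3)ˣ}
    (h : u • checkColumn φ j = w • checkColumn φ k) (h0 : checkColumn φ j ≠ 0) :
    u = w ∧ checkColumn φ j = checkColumn φ k := by
  rcases ternary_units_eq_or_eq_neg w u with rfl | rfl
  · exact ⟨rfl, smul_left_cancel w h⟩
  · rw [Units.neg_smul, ← smul_neg] at h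
    exact absurd (hφ.normalized (smul_left_cancel u h)) h0

theorem injective_ball_fiber (hφ : IsTripleCheck φ o) (hf : IsLatin (checkColumn φ) o f)
    (v : TernaryWord n) (r : K) :
    Injective fun e : {e // φ (ballVec e) = r} =>
      (v + ballVec e.1) o - f (v + ballVec e.1) := by
  rintro ⟨e, he⟩ ⟨e', he'⟩ heq
  rw [Subtype.mk.injEq]
  dsimp only at heq
  rcases eq_or_ne r 0 with rfl | hr
  · obtain ⟨s, hs⟩ := hφ.exists_ballVec_eq_single he
    obtain ⟨s', hs'⟩ := hφ.exists_ballVec_eq_single he'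
    refine ballVec_injective ?_
    rw [hs, hs', hf.add_single, hf.add_single] at heq
    rw [hs, hs', show s = s' by simpa using heq]
  rcases e with _ | ⟨j, u⟩
  · exact absurd ((map_zero φ).symm.trans he).symm hr
  rcases e' with _ | ⟨k, w⟩
  · exact absurd ((map_zero φ).symm.trans he').symm hr
  have hj : checkColumn φ j ≠ 0 := fun h => hr (by rw [← he, map_ballVec_some, h, smul_zero])
  rw [map_ballVec_some] at he he'
  obtain ⟨rfl, hc⟩ := hφ.eq_of_smul_checkColumn_eq (he.trans he'.symm) hj
  have ho : ∀ i, checkColumn φ i ≠ 0 → ballVec (some (i, u)) o = 0 := fun i hi =>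
    Pi.single_eq_of_ne (fun h => hi (hφ.checkColumn_eq_zero_iff.2 h.symm)) _
  rw [Pi.add_apply, Pi.add_apply, ho j hj, ho k (hc ▸ hj), sub_right_inj] at heq
  rw [hf.eq_of_apply_add_single_eq u.ne_zero hc heq]

theorem existsUnique_ballVec (hφ : IsTripleCheck φ o) (hf : IsLatin (checkColumn φ) o f)
    (v : TernaryWord n) (r : K) (t : ZMod 3) :
    ∃! e, φ (ballVec e) = r ∧ (v + ballVec e) o - f (v + ballVec e) = t := by
  have hbij := (hφ.injective_ball_fiber hf v r).bijective_of_nat_card_le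
    (by rw [hφ.card_fiber, Nat.card_zmod])
  obtain ⟨⟨e, he⟩, het, huniq⟩ := hbij.existsUnique t
  exact ⟨e, ⟨he, het⟩, fun e' ⟨he', het'⟩ => congrArg Subtype.val (huniq ⟨e', he'⟩ het')⟩

theorem isOnePerfectCode_graphCode (hφ : IsTripleCheck φ o) (hf : IsLatin (checkColumn φ) o f)
    (b : K) : IsOnePerfectCode (ternaryHammingGraph n) (graphCode φ b o f) := by
  rw [isOnePerfectCode_iff_ballVec]
  intro v
  simpa only [graphCode, Set.mem_ofPred_eq, map_add, eq_sub_iff_add_eq', sub_eq_zero]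
    using hφ.existsUnique_ballVec hf v (b - φ v) 0

theorem bijective_prod_ballVec (hφ : IsTripleCheck φ o) {Λ : TernaryWord n →ₗ[ZMod 3] ZMod 3}
    (hΛ : IsLatin (checkColumn φ) o Λ) :
    Bijective fun e => (φ.prod (LinearMap.proj o - Λ)) (ballVec e) := by
  rw [bijective_iff_existsUnique]
  rintro ⟨r, t⟩
  simpa only [Prod.ext_iff, LinearMap.prod_apply, Function.prod,
    LinearMap.sub_apply, LinearMap.proj_apply, zero_add]
    using hφ.existsUnique_ballVec hΛ 0 r t

end IsTripleCheck

theorem codeRank_le_of_map_eq (hs : Surjective φ)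
    (hC : ∀ x ∈ C, φ x = b) : codeRank C ≤ n - Module.finrank (ZMod 3) K := by
  have hle : vectorSpan (ZMod 3) C ≤ LinearMap.ker φ := by
    refine Submodule.span_le.2 ?_
    rintro _ ⟨x, hx, y, hy, rfl⟩
    simp [hC x hx, hC y hy]
  have hker := LinearMap.finrank_range_add_finrank_ker φ
  rw [LinearMap.range_eq_top.2 hs, finrank_top, Module.finrank_fin_fun] at hker
  rw [codeRank, direction_affineSpan]
  exact (Submodule.finrank_mono hle).trans (Nat.le_sub_of_add_le' hker.le)

theorem IsTripleCheck.graphCode_mem (hφ : IsTripleCheck φ o)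
    (hs : Surjective φ) (hK : Module.finrank (ZMod 3) K + 1 = m)
    (hf : IsLatin (checkColumn φ) o f) (b : K) :
    graphCode φ b o f ∈ onePerfectCodesOfRankLE n m 1 := by
  refine ⟨hφ.isOnePerfectCode_graphCode hf b, (codeRank_le_of_map_eq hs fun _ hx => hx.1).trans ?_⟩
  omega

end LinearChecks

section SwitchingGraphCodes

variable {n m : ℕ} {K : Type*} [AddCommGroup K] [Module (ZMod 3) K]
  {φ : TernaryWord n →ₗ[ZMod 3] K} {o j k : Fin n} {b : K} {f g : TernaryWord n → ZMod 3}
  {Λ : TernaryWord n →ₗ[ZMod 3] ZMod 3}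

theorem hammingAut_mulSingle_addRight (o : Fin n) (c : ZMod 3) (x : TernaryWord n) :
    hammingAut 1 (Pi.mulSingle o (Equiv.addRight c)) x = x + Pi.single o c := by
  funext k
  change Pi.mulSingle (M := fun _ => Equiv.Perm (ZMod 3)) o (Equiv.addRight c) k (x k) = _
  rcases eq_or_ne k o with rfl | hk <;> simp [*]

namespace IsTripleCheck

theorem switchConnected_of_eq_or_eq_add (hφ : IsTripleCheck φ o) (hs : Surjective φ)
    (hK : Module.finrank (ZMod 3) K + 1 = m) (hf : IsLatin (checkColumn φ) o f)
    (hg : IsLatin (checkColumn φ) o g) {c : ZMod 3} (hfg : ∀ x, g x = f x ∨ g x = f x + c) :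
    SwitchConnected m 1 (graphCode φ b o f) (graphCode φ b o g) := by
  refine switchConnected_of_subset_union (hφ.graphCode_mem hs hK hf b)
    (hφ.graphCode_mem hs hK hg b) (actsOnlyOn_mulSingle o (Equiv.addRight c)) ?_ ?_
  · rintro x ⟨hx, hxo⟩
    rcases hfg x with h | h
    · exact .inl ⟨hx, hxo.trans h⟩
    · refine .inr ⟨x + Pi.single o (-c), ⟨(hφ.map_add_single x _).trans hx, ?_⟩, ?_⟩
      · rw [hf.add_single, Pi.add_apply, Pi.single_eq_same, hxo, h, add_neg_cancel_right]
      · rw [hammingAut_mulSingle_addRight, add_assoc, ← Pi.single_add, neg_add_cancel,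
          Pi.single_zero, add_zero]
  · rintro x ⟨hx, hxo⟩
    rcases hfg x with h | h
    · exact .inl ⟨hx, hxo.trans h.symm⟩
    · refine .inr ?_
      rw [Set.mem_preimage, hammingAut_mulSingle_addRight]
      refine ⟨(hφ.map_add_single x c).trans hx, ?_⟩
      rw [hg.add_single, Pi.add_apply, Pi.single_eq_same, hxo, h]

theorem comp_swap_mem_graphCode (hφ : IsTripleCheck φ o) (hjk : j ≠ k)
    (h : checkColumn φ j = checkColumn φ k) {x : TernaryWord n} :
    x ∘ Equiv.swap j k ∈ graphCode φ b o f ↔ φ x = b ∧ x o = f (x ∘ Equiv.swap j k) := by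
  have hmap : φ (x ∘ Equiv.swap j k) = φ x := by
    rw [comp_swap_eq_add_smul, map_add, map_smul, map_unitDiff h, smul_zero, add_zero]
  have ho : (x ∘ Equiv.swap j k) o = x o := congrArg x <| Equiv.swap_apply_of_ne_of_ne
    (hφ.ne_of_checkColumn_eq hjk h) (hφ.ne_of_checkColumn_eq hjk.symm h.symm)
  rw [graphCode, Set.mem_ofPred_eq, hmap, ho]

theorem isLatin_straighten (hφ : IsTripleCheck φ o) (hf : IsLatin (checkColumn φ) o f)
    (hjk : j ≠ k) (h : checkColumn φ j = checkColumn φ k) (s : ZMod 3) :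
    IsLatin (checkColumn φ) o (straighten j k s f) :=
  hf.isLatin_straighten (hφ.ne_of_checkColumn_eq hjk h)
    (hφ.ne_of_checkColumn_eq hjk.symm h.symm) h s

theorem switchConnected_straighten (hφ : IsTripleCheck φ o) (hs : Surjective φ)
    (hK : Module.finrank (ZMod 3) K + 1 = m) (hf : IsLatin (checkColumn φ) o f)
    (hjk : j ≠ k) (h : checkColumn φ j = checkColumn φ k) (s : ZMod 3) :
    SwitchConnected m 1 (graphCode φ b o f) (graphCode φ b o (straighten j k s f)) := by
  have hinvol : ∀ x : TernaryWord n, (x ∘ Equiv.swap j k) ∘ Equiv.swap j k = x := fun x =>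
    funext fun i => congrArg x (Equiv.swap_apply_self j k i)
  refine switchConnected_of_subset_union (hφ.graphCode_mem hs hK hf b)
    (hφ.graphCode_mem hs hK (hφ.isLatin_straighten hf hjk h s) b) (actsOnlyOn_swap j k) ?_ ?_
  · rintro x ⟨hx, hxo⟩
    by_cases hxs : Δ_[unitDiff j k] f x = s
    · exact .inl ⟨hx, hxo.trans (straighten_of_eq hxs)⟩
    · exact .inr ⟨x ∘ Equiv.swap j k, (hφ.comp_swap_mem_graphCode hjk h).2
        ⟨hx, hxo.trans (straighten_of_ne hxs)⟩, hinvol x⟩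
  · rintro x ⟨hx, hxo⟩
    by_cases hxs : Δ_[unitDiff j k] f x = s
    · exact .inl ⟨hx, hxo.trans (straighten_of_eq hxs).symm⟩
    · have hxs' : Δ_[unitDiff j k] f (x ∘ Equiv.swap j k) ≠ s := by
        rwa [comp_swap_eq_add_smul, hf.fwdDiff_add_smul x h h]
      refine .inr ((hφ.comp_swap_mem_graphCode hjk h).2 ⟨hx, ?_⟩)
      rw [straighten_of_ne hxs', hinvol, hxo]

theorem exists_fwdDiff_eq_on (hφ : IsTripleCheck φ o) (hs : Surjective φ)
    (hK : Module.finrank (ZMod 3) K + 1 = m) (hΛ : IsLatin (checkColumn φ) o Λ)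
    (hf : IsLatin (checkColumn φ) o f) (S : Finset (Fin n × Fin n)) :
    ∃ g, IsLatin (checkColumn φ) o g ∧
      SwitchConnected m 1 (graphCode φ b o f) (graphCode φ b o g) ∧
      ∀ i l, (i, l) ∈ S → checkColumn φ i = checkColumn φ l →
        ∀ x, Δ_[unitDiff i l] g x = Λ (unitDiff i l) := by
  induction S using Finset.induction_on with
  | empty => exact ⟨f, hf, .refl, by simp⟩
  | insert p S _ ih =>
    obtain ⟨j, k⟩ := p
    obtain ⟨g, hg, hconn, hS⟩ := ih
    by_cases h : j ≠ k ∧ checkColumn φ j = checkColumn φ k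
    · obtain ⟨hjk, h⟩ := h
      have hne : Λ (unitDiff j k) ≠ 0 := by simpa [fwdDiff] using hΛ.fwdDiff_ne_zero 0 hjk h
      refine ⟨_, hφ.isLatin_straighten hg hjk h (Λ (unitDiff j k)),
        hconn.trans (hφ.switchConnected_straighten hs hK hg hjk h _), fun i l hil h' x => ?_⟩
      rcases Finset.mem_insert.1 hil with heq | hil
      · obtain ⟨rfl, rfl⟩ := Prod.mk.inj heq
        exact hg.fwdDiff_straighten_self hjk h hne x
      · exact hΛ.fwdDiff_straighten_of_fwdDiff_eq hg h h' (hS i l hil h' x)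
    · refine ⟨g, hg, hconn, fun i l hil h' x => ?_⟩
      rcases Finset.mem_insert.1 hil with heq | hil
      · obtain ⟨rfl, rfl⟩ := Prod.mk.inj heq
        obtain rfl : i = l := by
          by_contra hne
          exact h ⟨hne, h'⟩
        simp [unitDiff_self, fwdDiff]
      · exact hS i l hil h' x

/-- The difference `d = g - Λ` is constant along each block. Replacing it by `0` where it is equal
to `1`, and then also where it is equal to `2`, is a shift of the coordinate `o` in both steps. -/
theorem switchConnected_of_fwdDiff_eq (hφ : IsTripleCheck φ o) (hs : Surjective φ)
    (hK : Module.finrank (ZMod 3) K + 1 = m) (hΛ : IsLatin (checkColumn φ) o Λ)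
    (hg : IsLatin (checkColumn φ) o g)
    (hinc : ∀ i l, checkColumn φ i = checkColumn φ l →
      ∀ x, Δ_[unitDiff i l] g x = Λ (unitDiff i l)) :
    SwitchConnected m 1 (graphCode φ b o g) (graphCode φ b o Λ) := by
  let d (x : TernaryWord n) : ZMod 3 := g x - Λ x
  have hdo : ∀ x t, d (x + Pi.single o t) = d x := fun x t => by
    simp only [d, hg.add_single, hΛ.add_single]
  have hd : ∀ x {i l}, checkColumn φ i = checkColumn φ l → d (x + unitDiff i l) = d x :=
    fun x i l h => by
      simp only [d, map_add, ← hinc i l h x, fwdDiff]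
      ring
  let twist (h : ZMod 3 → ZMod 3) (x : TernaryWord n) : ZMod 3 := Λ x + h (d x)
  have htwist : ∀ h, IsLatin (checkColumn φ) o (twist h) := fun h =>
    hΛ.add_blockConstant (d := h ∘ d) (fun x t => congrArg h (hdo x t))
      fun x _ _ hil => congrArg h (hd x hil)
  have hg_eq : twist id = g := funext fun x => add_sub_cancel _ _
  have hΛ_eq : twist 0 = Λ := funext fun x => add_zero _
  let kill (z : ZMod 3) : ZMod 3 := if z = 1 then 0 else z
  have hkill : ∀ z, kill z = z ∨ kill z = z + 2 := by decide
  have hkill' : ∀ z, 0 = kill z ∨ 0 = kill z + 1 := by decide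
  have h1 := hφ.switchConnected_of_eq_or_eq_add (b := b) hs hK (htwist id) (htwist kill) (c := 2)
    fun x => by simpa only [twist, id, add_assoc, add_right_inj] using hkill (d x)
  have h2 := hφ.switchConnected_of_eq_or_eq_add (b := b) hs hK (htwist kill) (htwist 0) (c := 1)
    fun x => by simpa only [twist, Pi.zero_apply, add_assoc, add_right_inj] using hkill' (d x)
  rw [hg_eq] at h1
  rw [hΛ_eq] at h2
  exact h1.trans h2

theorem switchConnected_linear (hφ : IsTripleCheck φ o) (hs : Surjective φ)
    (hK : Module.finrank (ZMod 3) K + 1 = m) (hΛ : IsLatin (checkColumn φ) o Λ)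
    (hf : IsLatin (checkColumn φ) o f) :
    SwitchConnected m 1 (graphCode φ b o f) (graphCode φ b o Λ) := by
  obtain ⟨g, hg, hfg, hinc⟩ := hφ.exists_fwdDiff_eq_on (b := b) hs hK hΛ hf Finset.univ
  exact hfg.trans (hφ.switchConnected_of_fwdDiff_eq hs hK hΛ hg
    fun i l => hinc i l (Finset.mem_univ _))

end IsTripleCheck

end SwitchingGraphCodes

section StructureOfCodes

variable {n : ℕ} {K : Type*} [AddCommGroup K] [Module (ZMod 3) K]
  {φ : TernaryWord n →ₗ[ZMod 3] K} {o j k : Fin n} {b : K} {C : Set (TernaryWord n)}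

theorem IsTripleCheck.exists_coloring (hφ : IsTripleCheck φ o) :
    ∃ σ : Fin n → ZMod 3, ∀ {j k}, j ≠ k → checkColumn φ j = checkColumn φ k → σ j ≠ σ k := by
  have hfiber : ∀ r, ∃ τ : Fin n → ZMod 3, Set.InjOn τ {j | checkColumn φ j = r} := by
    intro r
    have hcard : Set.encard {j | checkColumn φ j = r} ≤ Set.encard (Set.univ : Set (ZMod 3)) := by
      let g : {j | checkColumn φ j = r} → {e // φ (ballVec e) = r} := fun j =>
        ⟨some (j, 1), by rw [map_ballVec_some, one_smul, j.2]⟩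
      have hg : Injective g := fun j k h => Subtype.ext
        (congrArg Prod.fst (Option.some.inj (congrArg Subtype.val h)))
      have hle := Nat.card_le_card_of_injective g hg
      rw [hφ.card_fiber] at hle
      rw [Set.encard_univ, ENat.card_eq_coe_natCard, Nat.card_zmod, ← Set.Finite.cast_ncard_eq
        (Set.toFinite _)]
      exact_mod_cast hle
    obtain ⟨τ, -, hτ⟩ := (Set.toFinite {j | checkColumn φ j = r}).exists_injOn_of_encard_le hcard
    exact ⟨τ, hτ⟩
  choose τ hτ using hfiber
  refine ⟨fun j => τ (checkColumn φ j) j, fun {j k} hjk h => ?_⟩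
  dsimp only
  rw [h]
  exact (hτ _).ne h rfl hjk

theorem IsTripleCheck.exists_isLatin_linear (hφ : IsTripleCheck φ o) :
    ∃ Λ : TernaryWord n →ₗ[ZMod 3] ZMod 3, IsLatin (checkColumn φ) o Λ := by
  obtain ⟨σ, hσ⟩ := hφ.exists_coloring
  let Λ := Fintype.linearCombination (ZMod 3) (Function.update σ o 0)
  have hΛ : ∀ j t, Λ (Pi.single j t) = t * Function.update σ o 0 j := fun j t =>
    Fintype.linearCombination_apply_single _ _ _ _
  refine ⟨Λ, fun x t => ?_, fun x j k hjk h => ?_⟩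
  · rw [map_add, hΛ, Function.update_self, mul_zero, add_zero]
  · rw [fwdDiff, map_add, add_sub_cancel_left, unitDiff, map_sub, hΛ, hΛ, one_mul, one_mul,
      Function.update_of_ne (hφ.ne_of_checkColumn_eq hjk h).symm,
      Function.update_of_ne (hφ.ne_of_checkColumn_eq hjk.symm h.symm).symm]
    exact sub_ne_zero.2 (hσ hjk h)

theorem update_eq_add_single (x : TernaryWord n) (o : Fin n) (t : ZMod 3) :
    Function.update x o t = x + Pi.single o (t - x o) := by
  funext k
  rcases eq_or_ne k o with rfl | hk <;> simp [*]

theorem IsOnePerfectCode.eq_of_update_mem (hC : IsOnePerfectCode (ternaryHammingGraph n) C)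
    {x : TernaryWord n} {s t : ZMod 3} (hs : Function.update x o s ∈ C)
    (ht : Function.update x o t ∈ C) : s = t := by
  by_contra hst
  let u : (ZMod 3)ˣ := Units.mk0 (t - s) (sub_ne_zero.2 (Ne.symm hst))
  have h := (isOnePerfectCode_iff_ballVec.1 hC (Function.update x o s)).unique
    (y₁ := none) (y₂ := some (o, u)) (by simpa [ballVec] using hs)
    (by simpa [ballVec, u, update_eq_add_single, add_assoc, ← Pi.single_add] using ht)
  exact absurd h (Option.some_ne_none _).symm

theorem IsOnePerfectCode.ne_of_update_add_unitDiff_mem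
    (hC : IsOnePerfectCode (ternaryHammingGraph n) C) {x : TernaryWord n} {s t : ZMod 3}
    (hjk : j ≠ k) (hoj : o ≠ j) (hok : o ≠ k) (hs : Function.update x o s ∈ C)
    (ht : Function.update (x + unitDiff j k) o t ∈ C) : t ≠ s := by
  rintro rfl
  have hmem : Function.update x o t + unitDiff j k ∈ C := by
    convert ht using 1
    funext i
    rcases eq_or_ne i o with rfl | hi <;> simp [unitDiff, *]
  have h := (isOnePerfectCode_iff_ballVec.1 hC (Function.update x o t + Pi.single j 1)).unique
    (y₁ := some (j, -1)) (y₂ := some (k, -1)) (by simpa [ballVec, Pi.single_neg] using hs)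
    (by simpa [ballVec, Pi.single_neg, unitDiff, sub_eq_add_neg, add_assoc] using hmem)
  exact hjk (congrArg Prod.fst (Option.some.inj h))

theorem IsTripleCheck.exists_update_mem (hφ : IsTripleCheck φ o)
    (hC : IsOnePerfectCode (ternaryHammingGraph n) C) (hb : ∀ x ∈ C, φ x = b)
    {x : TernaryWord n} (hx : φ x = b) : ∃ t, Function.update x o t ∈ C := by
  obtain ⟨e, he, -⟩ := isOnePerfectCode_iff_ballVec.1 hC x
  have hker : φ (ballVec e) = 0 := by simpa [hx] using hb _ he
  obtain ⟨s, hs⟩ := hφ.exists_ballVec_eq_single hker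
  refine ⟨x o + s, ?_⟩
  rwa [update_eq_add_single, add_sub_cancel_left, ← hs]

/-- Outside of `φ x = b`, where the code says nothing, `f` is an arbitrary Latin function. -/
theorem IsTripleCheck.exists_eq_graphCode (hφ : IsTripleCheck φ o)
    (hC : IsOnePerfectCode (ternaryHammingGraph n) C) (hb : ∀ x ∈ C, φ x = b) :
    ∃ f, IsLatin (checkColumn φ) o f ∧ C = graphCode φ b o f := by
  classical
  obtain ⟨Λ, hΛ⟩ := hφ.exists_isLatin_linear
  have hex : ∀ x, ∃ t, φ x = b → Function.update x o t ∈ C := fun x => by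
    by_cases hx : φ x = b
    · exact (hφ.exists_update_mem hC hb hx).imp fun _ ht _ => ht
    · exact ⟨0, fun h => absurd h hx⟩
  choose t ht using hex
  refine ⟨fun x => if φ x = b then t x else Λ x, ⟨fun x s => ?_, fun x j k hjk h => ?_⟩,
    Set.ext fun x => ?_⟩
  · have hupd : Function.update (x + Pi.single o s) o = Function.update x o := by
      funext c k
      rcases eq_or_ne k o with rfl | hk <;> simp [*]
    simp only [hφ.map_add_single, hΛ.add_single]
    split_ifs with hx
    · exact hC.eq_of_update_mem (hupd ▸ ht _ ((hφ.map_add_single x s).trans hx)) (ht x hx)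
    · rfl
  · have hmap : φ (x + unitDiff j k) = φ x := by rw [map_add, map_unitDiff h, add_zero]
    simp only [fwdDiff, hmap]
    split_ifs with hx
    · exact sub_ne_zero.2 (hC.ne_of_update_add_unitDiff_mem hjk (hφ.ne_of_checkColumn_eq hjk h)
        (hφ.ne_of_checkColumn_eq hjk.symm h.symm) (ht x hx) (ht _ (hmap.trans hx)))
    · exact hΛ.fwdDiff_ne_zero x hjk h
  · simp only [graphCode, Set.mem_ofPred_eq]
    constructor
    · intro hx
      rw [if_pos (hb x hx)]
      exact ⟨hb x hx, hC.eq_of_update_mem (by rwa [Function.update_eq_self]) (ht x (hb x hx))⟩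
    · rintro ⟨hx, hxo⟩
      rw [if_pos hx] at hxo
      simpa only [← hxo, Function.update_eq_self] using ht x hx

end StructureOfCodes

section Counting

variable {n : ℕ} {K : Type*} [AddCommGroup K] [Module (ZMod 3) K]
  {φ : TernaryWord n →ₗ[ZMod 3] K} {b : K} {C : Set (TernaryWord n)}

theorem IsOnePerfectCode.card_ball_fiber_mul_card
    (hC : IsOnePerfectCode (ternaryHammingGraph n) C) (hs : Surjective φ) (hb : ∀ x ∈ C, φ x = b)
    (r : K) :
    Nat.card {e // φ (ballVec e) = r} * Nat.card C = Nat.card (LinearMap.ker φ) := by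
  have tiling : {p : Option (Fin n × (ZMod 3)ˣ) × C // φ (ballVec p.1) = r} ≃
      {v // φ v = b - r} :=
    (Equiv.ofBijective _ hC.bijective_sub_ballVec).subtypeEquiv fun p => by
      rw [Equiv.ofBijective_apply, map_sub, hb _ p.2.2, sub_right_inj]
  rw [← Nat.card_prod]
  exact Nat.card_congr <| Equiv.prodSubtypeFstEquivSubtypeProd.symm.trans <| tiling.trans <|
    φ.toAddMonoidHom.fiberEquivKerOfSurjective hs (b - r)

theorem IsOnePerfectCode.card_mul_card_ball_fiber
    (hC : IsOnePerfectCode (ternaryHammingGraph n) C) (hs : Surjective φ) (hb : ∀ x ∈ C, φ x = b)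
    (r : K) : Nat.card K * Nat.card {e // φ (ballVec e) = r} = 2 * n + 1 := by
  have : Finite K := .of_surjective φ hs
  have : Fintype K := .ofFinite K
  have : Nonempty C := hC.nonempty.to_subtype
  have hconst : ∀ p, Nat.card {e // φ (ballVec e) = p} = Nat.card {e // φ (ballVec e) = r} :=
    fun p => Nat.eq_of_mul_eq_mul_right Nat.card_pos <|
      (hC.card_ball_fiber_mul_card hs hb p).trans (hC.card_ball_fiber_mul_card hs hb r).symm
  have hball : Nat.card (Option (Fin n × (ZMod 3)ˣ)) = 2 * n + 1 := by
    rw [Finite.card_option, Nat.card_prod, Nat.card_fin, Nat.card_units, Nat.card_zmod, mul_comm]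
  rw [← hball, ← Nat.card_congr (Equiv.sigmaFiberEquiv fun e => φ (ballVec e)), Nat.card_sigma,
    Finset.sum_congr rfl fun p _ => hconst p, Finset.sum_const, Finset.card_univ, smul_eq_mul,
    Nat.card_eq_fintype_card]

theorem card_ball_fiber_zero (φ : TernaryWord n →ₗ[ZMod 3] K) :
    Nat.card {e // φ (ballVec e) = 0} = 2 * Nat.card {j // checkColumn φ j = 0} + 1 := by
  let g : Option ({j // checkColumn φ j = 0} × (ZMod 3)ˣ) → Option (Fin n × (ZMod 3)ˣ) :=
    Option.map (Prod.map Subtype.val id)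
  have hg : Injective g := Option.map_injective (Subtype.val_injective.prodMap injective_id)
  have hrange : Set.range g = {e | φ (ballVec e) = 0} := by
    ext e
    rw [Set.mem_ofPred_eq]
    rcases e with _ | ⟨j, u⟩
    · exact iff_of_true ⟨none, rfl⟩ (map_zero φ)
    · rw [map_ballVec_some, smul_eq_zero_iff_eq]
      simp [g, Option.exists]
  change Nat.card {e | φ (ballVec e) = 0} = _
  rw [← hrange, Nat.card_range_of_injective hg, Finite.card_option, Nat.card_prod, Nat.card_units,
    Nat.card_zmod, mul_comm]

theorem exists_isTripleCheck (hcard : ∀ r, Nat.card {e // φ (ballVec e) = r} = 3)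
    (hnorm : ∀ {j k}, checkColumn φ j = -checkColumn φ k → checkColumn φ j = 0) :
    ∃ o, IsTripleCheck φ o := by
  have hzero : Nat.card {j // checkColumn φ j = 0} = 1 := by
    have h := (card_ball_fiber_zero φ).symm.trans (hcard 0)
    omega
  obtain ⟨⟨o, ho⟩, huniq⟩ := Nat.card_eq_one_iff_exists.1 hzero
  exact ⟨o, hcard, fun {j} => ⟨fun hj => congrArg Subtype.val (huniq ⟨j, hj⟩), fun h => h ▸ ho⟩,
    hnorm⟩

end Counting

section CheckMaps

theorem exists_surjective_le_ker {F V : Type*} [DivisionRing F] [AddCommGroup V] [Module F V]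
    [Module.Finite F V] (W : Submodule F V) {q : ℕ}
    (h : Module.finrank F W + q ≤ Module.finrank F V) :
    ∃ φ : V →ₗ[F] (Fin q → F), Surjective φ ∧ W ≤ LinearMap.ker φ := by
  have hq : q ≤ Module.finrank F (V ⧸ W) := by
    rw [← Submodule.finrank_quotient_add_finrank W] at h
    omega
  let ψ : (V ⧸ W) →ₗ[F] (Fin q → F) :=
    LinearMap.funLeft F F (Fin.castLE hq) ∘ₗ (Module.finBasis F (V ⧸ W)).equivFun
  have hψ : Surjective ψ := (LinearMap.funLeft_surjective_of_injective F F _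
    (Fin.castLE_injective hq)).comp (Module.finBasis F (V ⧸ W)).equivFun.surjective
  exact ⟨ψ ∘ₗ W.mkQ, hψ.comp W.mkQ_surjective, W.ker_mkQ.ge.trans (LinearMap.ker_le_ker_comp _ _)⟩

theorem exists_units_smul_neg_eq (R M : Type*) [Ring R] [AddCommGroup M] [Module R M] :
    ∃ s : M → Rˣ, ∀ p, s (-p) • -p = s p • p := by
  classical
  let _ : LinearOrder M := linearOrderOfSTO WellOrderingRel
  refine ⟨fun p => if p ≤ -p then 1 else -1, fun p => ?_⟩
  simp only [neg_neg]
  rcases lt_trichotomy p (-p) with h | h | h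
  · simp [h.le, h.not_ge]
  · rw [← h]
  · simp [h.le, h.not_ge]

variable {n m r q : ℕ} {K : Type*} [AddCommGroup K] [Module (ZMod 3) K]

theorem ternary_eq_zero_of_eq_neg {p : K} (h : p = -p) : p = 0 := by
  have h2 : (2 : ZMod 3) • p = 0 := by
    rw [two_smul]
    exact add_eq_zero_iff_eq_neg.2 h
  exact (smul_eq_zero_iff_right (by decide)).1 h2

theorem exists_units_smul_eq_zero_of_eq_neg (K : Type*) [AddCommGroup K] [Module (ZMod 3) K] :
    ∃ s : K → (ZMod 3)ˣ, ∀ {p q}, s p • p = -(s q • q) → s p • p = 0 := by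
  obtain ⟨s, hs⟩ := exists_units_smul_neg_eq (ZMod 3) K
  refine ⟨s, fun {p q} h => ternary_eq_zero_of_eq_neg ?_⟩
  suffices heq : s p • p = s q • q by rwa [← heq] at h
  rcases ternary_units_eq_or_eq_neg (s p) (s q) with hu | hu
  · rw [hu, ← smul_neg] at h
    rw [smul_left_cancel _ h, hs]
  · rw [hu, Units.neg_smul, neg_inj] at h
    rw [smul_left_cancel _ h]

theorem exists_check_map {C : Set (TernaryWord n)} (hC : C.Nonempty) (hr : codeRank C + q ≤ n) :
    ∃ (φ : TernaryWord n →ₗ[ZMod 3] (Fin q → ZMod 3)) (b : Fin q → ZMod 3),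
      Surjective φ ∧ ∀ x ∈ C, φ x = b := by
  rw [codeRank, direction_affineSpan] at hr
  obtain ⟨φ, hs, hker⟩ := exists_surjective_le_ker (vectorSpan (ZMod 3) C) (q := q)
    (by rwa [Module.finrank_fin_fun])
  obtain ⟨c, hc⟩ := hC
  exact ⟨φ, φ c, hs, fun x hx => LinearMap.sub_mem_ker_iff.1 (hker (vsub_mem_vectorSpan _ hx hc))⟩

theorem exists_switchConnected_normalized {C : Set (TernaryWord n)}
    (hC : C ∈ onePerfectCodesOfRankLE n m r) (hr : codeRank C + q ≤ n) :
    ∃ D, SwitchConnected m r C D ∧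
      ∃ (φ : TernaryWord n →ₗ[ZMod 3] (Fin q → ZMod 3)) (b : Fin q → ZMod 3),
        Surjective φ ∧ (∀ x ∈ D, φ x = b) ∧
        ∀ {j k}, checkColumn φ j = -checkColumn φ k → checkColumn φ j = 0 := by
  obtain ⟨φ, b, hs, hb⟩ := exists_check_map hC.1.nonempty hr
  obtain ⟨s, hnorm⟩ := exists_units_smul_eq_zero_of_eq_neg (Fin q → ZMod 3)
  let a : Fin n → (ZMod 3)ˣ := fun j => s (checkColumn φ j)
  let L : TernaryWord n ≃ₗ[ZMod 3] TernaryWord n :=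
    LinearEquiv.piCongrRight fun j => LinearEquiv.smulOfUnit (a j)
  have hcol : ∀ j, checkColumn (φ ∘ₗ L.toLinearMap) j = a j • checkColumn φ j := by
    intro j
    have hL : L (Pi.single j 1) = Pi.single j (a j • 1) :=
      funext (Pi.apply_single (fun k (t : ZMod 3) => a k • t) (fun k => smul_zero (a k)) j 1)
    rw [checkColumn, LinearMap.comp_apply, LinearEquiv.coe_coe, hL,
      map_single_eq_smul_checkColumn, Units.smul_def, smul_eq_mul, mul_one, Units.smul_def]
  refine ⟨_, switchConnected_image_hammingAut hC 1 fun j => MulAction.toPerm (a j)⁻¹,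
    φ ∘ₗ L.toLinearMap, b, hs.comp L.surjective, ?_, fun {j k} h => ?_⟩
  · rintro _ ⟨x, hx, rfl⟩
    rw [← hb x hx, LinearMap.comp_apply]
    exact congrArg φ (funext fun k => smul_inv_smul (a k) (x k))
  · rw [hcol, hcol] at h
    rw [hcol]
    exact hnorm h

theorem exists_switchConnected_isTripleCheck (hm : 1 ≤ m) (hn : 2 * n + 1 = 3 ^ m)
    {C : Set (TernaryWord n)} (hC : C ∈ onePerfectCodesOfRankLE n m 1) :
    ∃ D, SwitchConnected m 1 C D ∧
      ∃ (φ : TernaryWord n →ₗ[ZMod 3] (Fin (m - 1) → ZMod 3)) (o : Fin n)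
        (b : Fin (m - 1) → ZMod 3),
        Surjective φ ∧ IsTripleCheck φ o ∧ ∀ x ∈ D, φ x = b := by
  have hmn : m ≤ n := by
    have hbernoulli : 1 + (m : ℤ) * 2 ≤ 3 ^ m := one_add_mul_le_pow (a := (2 : ℤ)) (by decide) m
    zify at hn ⊢
    linarith
  have hr : codeRank C + (m - 1) ≤ n := by
    have := hC.2
    omega
  obtain ⟨D, hCD, φ, b, hs, hb, hnorm⟩ := exists_switchConnected_normalized hC hr
  have hcard : ∀ r, Nat.card {e // φ (ballVec e) = r} = 3 := by
    intro r
    have h := (hCD.mem hC).1.card_mul_card_ball_fiber hs hb r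
    rw [hn, Nat.card_fun, Nat.card_zmod, Nat.card_fin,
      ← pow_sub_one_mul (Nat.one_le_iff_ne_zero.1 hm) 3] at h
    exact Nat.eq_of_mul_eq_mul_left (by positivity) h
  obtain ⟨o, hφ⟩ := exists_isTripleCheck hcard hnorm
  exact ⟨D, hCD, φ, o, b, hs, hφ, hb⟩

end CheckMaps

section HammingCodes

variable {n m : ℕ} {K : Type*} [AddCommGroup K] [Module (ZMod 3) K]
  {Φ Ψ : TernaryWord n →ₗ[ZMod 3] K} {π : Equiv.Perm (Fin n)} {u : Fin n → (ZMod 3)ˣ}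

/-- The linear map `Φ` is a parity check of a Hamming code: its columns represent every line of its
codomain exactly once. -/
def IsHammingCheck (Φ : TernaryWord n →ₗ[ZMod 3] K) : Prop :=
  Bijective fun e => Φ (ballVec e)

theorem IsHammingCheck.exists_checkColumn_eq (hΦ : IsHammingCheck Φ) (hΨ : IsHammingCheck Ψ)
    (j : Fin n) : ∃ (k : Fin n) (w : (ZMod 3)ˣ), w • checkColumn Ψ k = checkColumn Φ j := by
  obtain ⟨e, he⟩ := hΨ.surjective (checkColumn Φ j)
  rcases e with _ | ⟨k, w⟩
  · have h0 : Φ (ballVec (some (j, 1))) = Φ (ballVec none) := by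
      rw [map_ballVec_some, one_smul, ← he, ballVec, map_zero]
      exact map_zero Ψ
    exact absurd (hΦ.injective h0) (Option.some_ne_none _)
  · exact ⟨k, w, (map_ballVec_some Ψ k w).symm.trans he⟩

theorem IsHammingCheck.exists_perm (hΦ : IsHammingCheck Φ) (hΨ : IsHammingCheck Ψ) :
    ∃ (π : Equiv.Perm (Fin n)) (u : Fin n → (ZMod 3)ˣ),
      ∀ j, u j • checkColumn Ψ (π j) = checkColumn Φ j := by
  choose p u hpu using hΦ.exists_checkColumn_eq hΨ
  have hp : Injective p := fun j k hjk => by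
    have h : Φ (ballVec (some (j, u k))) = Φ (ballVec (some (k, u j))) := by
      rw [map_ballVec_some, map_ballVec_some, ← hpu, ← hpu, hjk, smul_comm]
    exact congrArg Prod.fst (Option.some.inj (hΦ.injective h))
  exact ⟨.ofBijective p (Finite.injective_iff_bijective.1 hp), u, hpu⟩

theorem map_eq_sum_smul_checkColumn (φ : TernaryWord n →ₗ[ZMod 3] K) (x : TernaryWord n) :
    φ x = ∑ j, x j • checkColumn φ j := by
  conv_lhs => rw [← Finset.univ_sum_single x, map_sum]
  exact Finset.sum_congr rfl fun j _ => map_single_eq_smul_checkColumn φ j (x j)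

theorem map_hammingAut_toPerm (h : ∀ j, u j • checkColumn Ψ (π j) = checkColumn Φ j)
    (x : TernaryWord n) :
    Ψ (hammingAut π (fun k => MulAction.toPerm (u (π.symm k))) x) = Φ x := by
  rw [map_eq_sum_smul_checkColumn, map_eq_sum_smul_checkColumn, ← Equiv.sum_comp π]
  refine Finset.sum_congr rfl fun j _ => ?_
  rw [← h, hammingAut, π.symm_apply_apply, MulAction.toPerm_apply, smul_assoc, smul_comm]

theorem IsHammingCheck.exists_hammingAut_image_eq (hΦ : IsHammingCheck Φ) (hΨ : IsHammingCheck Ψ)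
    (b d : K) : ∃ π θ, hammingAut π θ '' {x | Φ x = b} = {x | Ψ x = d} := by
  obtain ⟨π, u, h⟩ := hΦ.exists_perm hΨ
  obtain ⟨e, he⟩ := hΨ.surjective (d - b)
  let θ : Fin n → Equiv.Perm (ZMod 3) := fun k =>
    (MulAction.toPerm (u (π.symm k))).trans (Equiv.addRight (ballVec e k))
  have hmap : ∀ x, Ψ (hammingAut π θ x) = Φ x + (d - b) := fun x => by
    rw [← map_hammingAut_toPerm h, ← he, ← map_add]
    rfl
  have hpre : {x | Φ x = b} = hammingAut π θ ⁻¹' {x | Ψ x = d} := by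
    ext x
    rw [Set.mem_preimage, Set.mem_ofPred_eq, Set.mem_ofPred_eq, hmap, ← eq_sub_iff_add_eq,
      sub_sub_cancel]
  exact ⟨π, θ, hpre ▸ Set.image_preimage_eq _ (hammingAutEquiv π θ).surjective⟩

theorem exists_switchConnected_hamming (hm : 1 ≤ m) (hn : 2 * n + 1 = 3 ^ m)
    {C : Set (TernaryWord n)} (hC : C ∈ onePerfectCodesOfRankLE n m 1) :
    ∃ (Φ : TernaryWord n →ₗ[ZMod 3] (Fin (m - 1) → ZMod 3) × ZMod 3)
      (b : (Fin (m - 1) → ZMod 3) × ZMod 3),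
      IsHammingCheck Φ ∧ SwitchConnected m 1 C {x | Φ x = b} := by
  obtain ⟨D, hCD, φ, o, b, hs, hφ, hb⟩ := exists_switchConnected_isTripleCheck hm hn hC
  obtain ⟨f, hf, rfl⟩ := hφ.exists_eq_graphCode (hCD.mem hC).1 hb
  obtain ⟨Λ, hΛ⟩ := hφ.exists_isLatin_linear
  have hK : Module.finrank (ZMod 3) (Fin (m - 1) → ZMod 3) + 1 = m := by
    rw [Module.finrank_fin_fun, Nat.sub_add_cancel hm]
  have hset : graphCode φ b o Λ = {x | (φ.prod (LinearMap.proj o - Λ)) x = (b, 0)} := by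
    ext x
    simp [graphCode, sub_eq_zero]
  exact ⟨_, (b, 0), hφ.bijective_prod_ballVec hΛ,
    hset ▸ hCD.trans (hφ.switchConnected_linear hs hK hΛ hf)⟩

end HammingCodes

theorem theorem3p3 (m n : ℕ) (hm : 1 ≤ m) (hn : n = (3 ^ m - 1) / 2)
    (C D : onePerfectCodesOfRankLE n m 1) :
    Relation.ReflTransGen
      (fun A B : onePerfectCodesOfRankLE n m 1 =>
        IsTwoCoordinateSwitching (A : Set (TernaryWord n)) (B : Set (TernaryWord n)))
      C D := by
  have hn' : 2 * n + 1 = 3 ^ m := by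
    have hodd : Odd (3 ^ m) := Odd.pow (by decide)
    obtain ⟨q, hq⟩ := hodd
    omega
  obtain ⟨Φ, b, hΦ, hC⟩ := exists_switchConnected_hamming hm hn' C.2
  obtain ⟨Ψ, d, hΨ, hD⟩ := exists_switchConnected_hamming hm hn' D.2
  obtain ⟨π, θ, hπθ⟩ := hΦ.exists_hammingAut_image_eq hΨ b d
  have hΦΨ : SwitchConnected m 1 {x | Φ x = b} {x | Ψ x = d} :=
    hπθ ▸ switchConnected_image_hammingAut (hC.mem C.2) π θ
  exact SwitchConnected.reflTransGen ((hC.trans hΦΨ).trans hD.symm) C.2 D.2
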